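/- Let $\Omega$ and $\Delta$ be locally compact Hausdorff spaces, let $E$ be a full Hilbert $C_0(\Omega)$-module and $F$ a full Hilbert $C_0(\Delta)$-module (full: the linear span of the inner products is dense in the algebra). For $\omega\in\Omega$ let $\Xi^E_\omega = E/\{e\in E : \langle e,e\rangle(\omega)=0\}$ be the fibre of $E$ at $\omega$, a Hilbert space under $\langle e(\omega),g(\omega)\rangle=\langle e,g\rangle(\omega)$, where $e(\omega)$ denotes the class of $e$; put $\operatorname{supp}_\Omega e=\overline{\{\omega\in\Omega : e(\omega)\neq 0\}}$. Use the same notation for $F$ over $\Delta$, and let $\Xi^F=\bigsqcup_{\nu\in\Delta}\Xi^F_\nu$ carry the bundle topology, generated by the sets $\{\xi\in\Xi^F_\nu : \nu\in U,\ \|\xi-f(\nu)\|<\varepsilon\}$ with $U\subseteq\Delta$ open, $f\in F$ and $\varepsilon>0$. Let $\theta:E\to F$ be a $\mathbb{C}$-linear bijection (not assumed bounded) such that 1. $\theta$ and $\theta^{-1}$ are orthogonality preserving: for $e,g\in E$, $\langle e,g\rangle=0$ implies $\langle\theta(e),\theta(g)\rangle=0$, and for $f,h\in F$, $\langle f,h\rangle=0$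 implies $\langle\theta^{-1}(f),\theta^{-1}(h)\rangle=0$; 2. $\theta$ and $\theta^{-1}$ are quasi-local: $\operatorname{supp}_\Omega\theta^{-1}(\theta(e)\lambda)\subseteq\operatorname{supp}_\Omega e$ for all $e\in E$, $\lambda\in C_0(\Delta)$, and $\operatorname{supp}_\Delta\theta(\theta^{-1}(f)\mu)\subseteq\operatorname{supp}_\Delta f$ for all $f\in F$, $\mu\in C_0(\Omega)$. Then $\theta$ is bounded, and there are a homeomorphism $\sigma:\Delta\to\Omega$, a bounded continuous function $\psi:\Delta\to\mathbb{R}$ with $\psi(\nu)>0$ for all $\nu\in\Delta$, and for each $\nu\in\Delta$ a unitary operator $J_\nu$ from $\Xi^E_{\sigma(\nu)}$ onto $\Xi^F_\nu$, such that $$\theta(e)(\nu)=\psi(\nu)\,J_\nu(e(\sigma(\nu)))\qquad\text{for all } e\in E,\ \nu\in\Delta,$$ and for each fixed $e\in E$ the map $\Delta\to\Xi^F$, $\nu\mapsto J_\nu(e(\sigma(\nu)))$, is continuous. -/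

import Mathlib

open scoped ZeroAtInfty ComplexOrder InnerProductSpace

noncomputable section

/-- The pointwise order of `C₀(Ω)`, which is its usual order as a C*-algebra. -/
instance ZeroAtInftyContinuousMap.instPartialOrderComplex {Ω : Type*} [TopologicalSpace Ω] :
    PartialOrder C₀(Ω, ℂ) :=
  PartialOrder.lift (fun f : C₀(Ω, ℂ) => (f : Ω → ℂ)) DFunLike.coe_injective

namespace HilbertC0Module

/-! A Hilbert `C₀(Ω)`-module is a complete normed space `E` with an instance
`CStarModule C₀(Ω, ℂ) E`; the action `e a` is written `a • e` (the algebra is commutative), and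
the laws of the action follow from those of the inner product, which is definite.
Its value `⟨x, y⟩` is `⟪x, y⟫_C₀(Ω, ℂ)`, linear in `y`. -/

variable {Ω : Type*} [TopologicalSpace Ω]
  {E : Type*} [NormedAddCommGroup E] [NormedSpace ℂ E] [SMul C₀(Ω, ℂ) E] [CStarModule C₀(Ω, ℂ) E]

/-- The positive semidefinite form `(x, y) ↦ ⟨x, y⟩(ω)`. -/
abbrev preCore (E : Type*) [NormedAddCommGroup E] [NormedSpace ℂ E] [SMul C₀(Ω, ℂ) E]
    [CStarModule C₀(Ω, ℂ) E] (ω : Ω) : PreInnerProductSpace.Core ℂ E where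
  inner x y := ⟪x, y⟫_C₀(Ω, ℂ) ω
  conj_inner_symm x y := by
    rw [← CStarModule.star_inner (A := C₀(Ω, ℂ)) y x]; rfl
  re_inner_nonneg x := by
    have h : (0 : Ω → ℂ) ≤ ⟪x, x⟫_C₀(Ω, ℂ) :=
      CStarModule.inner_self_nonneg (A := C₀(Ω, ℂ)) (x := x)
    exact (Complex.le_def.1 (h ω)).1
  add_left x y z := by simp
  smul_left x y r := by simp

theorem inner_apply_eq_zero {ω : Ω} {x : E} (hx : ⟪x, x⟫_C₀(Ω, ℂ) ω = 0) (y : E) :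
    ⟪x, y⟫_C₀(Ω, ℂ) ω = 0 := by
  have h : ‖⟪x, y⟫_C₀(Ω, ℂ) ω‖ * ‖⟪y, x⟫_C₀(Ω, ℂ) ω‖ ≤
      RCLike.re (⟪x, x⟫_C₀(Ω, ℂ) ω) * RCLike.re (⟪y, y⟫_C₀(Ω, ℂ) ω) :=
    @InnerProductSpace.Core.inner_mul_inner_self_le ℂ E _ _ _ (preCore E ω) x y
  rw [← CStarModule.star_inner (A := C₀(Ω, ℂ)) x y, ZeroAtInftyContinuousMap.star_apply,
    norm_star, hx, map_zero, zero_mul] at h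
  exact norm_eq_zero.1 (mul_self_eq_zero.1 (le_antisymm h (mul_self_nonneg _)))

theorem inner_apply_eq_zero' {ω : Ω} (x : E) {y : E} (hy : ⟪y, y⟫_C₀(Ω, ℂ) ω = 0) :
    ⟪x, y⟫_C₀(Ω, ℂ) ω = 0 := by
  rw [← CStarModule.star_inner (A := C₀(Ω, ℂ)) y x, ZeroAtInftyContinuousMap.star_apply,
    inner_apply_eq_zero hy, star_zero]

/-- The elements of `E` that vanish at `ω`. -/
def vanishing (E : Type*) [NormedAddCommGroup E] [NormedSpace ℂ E] [SMul C₀(Ω, ℂ) E]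
    [CStarModule C₀(Ω, ℂ) E] (ω : Ω) : Submodule ℂ E where
  carrier := {x | ⟪x, x⟫_C₀(Ω, ℂ) ω = 0}
  zero_mem' := by simp
  add_mem' {x y} hx hy := by
    simp only [Set.mem_ofPred_eq] at hx hy ⊢
    simp [hx, hy, inner_apply_eq_zero hx, inner_apply_eq_zero hy]
  smul_mem' c x hx := by
    simp only [Set.mem_ofPred_eq] at hx ⊢
    simp [hx]

/-- The fibre at `ω` of the Hilbert bundle of `E`: the quotient of `E` by the elements that
vanish at `ω`. -/
def Fibre (E : Type*) [NormedAddCommGroup E] [NormedSpace ℂ E] [SMul C₀(Ω, ℂ) E]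
    [CStarModule C₀(Ω, ℂ) E] (ω : Ω) : Type _ :=
  E ⧸ vanishing E ω

/-- The inner product of a fibre: `⟨x(ω), y(ω)⟩ = ⟨x, y⟩(ω)`. -/
abbrev fibreCore (E : Type*) [NormedAddCommGroup E] [NormedSpace ℂ E] [SMul C₀(Ω, ℂ) E]
    [CStarModule C₀(Ω, ℂ) E] (ω : Ω) : InnerProductSpace.Core ℂ (E ⧸ vanishing E ω) where
  inner u v := Quotient.liftOn₂' u v (fun x y => ⟪x, y⟫_C₀(Ω, ℂ) ω) (by
    intro x₁ y₁ x₂ y₂ hx hy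
    rw [Submodule.quotientRel_def] at hx hy
    have h1 := inner_apply_eq_zero hx y₁
    have h2 := inner_apply_eq_zero' x₂ hy
    simp only [CStarModule.inner_sub_left, CStarModule.inner_sub_right,
      ZeroAtInftyContinuousMap.sub_apply] at h1 h2
    exact (sub_eq_zero.1 h1).trans (sub_eq_zero.1 h2))
  conj_inner_symm u v := by
    induction u using Submodule.Quotient.induction_on
    induction v using Submodule.Quotient.induction_on
    exact (preCore E ω).conj_inner_symm _ _
  re_inner_nonneg u := by
    induction u using Submodule.Quotient.induction_on
    exact (preCore E ω).re_inner_nonneg _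
  add_left u v w := by
    induction u using Submodule.Quotient.induction_on
    induction v using Submodule.Quotient.induction_on
    induction w using Submodule.Quotient.induction_on
    exact (preCore E ω).add_left _ _ _
  smul_left u v r := by
    induction u using Submodule.Quotient.induction_on
    induction v using Submodule.Quotient.induction_on
    exact (preCore E ω).smul_left _ _ r
  definite u hu := by
    induction u using Submodule.Quotient.induction_on with
    | H x => exact (Submodule.Quotient.mk_eq_zero _).2 hu

instance (ω : Ω) : NormedAddCommGroup (Fibre E ω) :=
  (fibreCore E ω).toNormedAddCommGroup

instance (ω : Ω) : InnerProductSpace ℂ (Fibre E ω) :=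
  InnerProductSpace.ofCore (fibreCore E ω).toCore

/-- The value `x(ω)` of `x` at `ω`. -/
def eval (ω : Ω) (x : E) : Fibre E ω :=
  Submodule.Quotient.mk x

theorem inner_eval (ω : Ω) (x y : E) : ⟪eval ω x, eval ω y⟫_ℂ = ⟪x, y⟫_C₀(Ω, ℂ) ω := rfl

/-- The total space of the Hilbert bundle of `E` over `Ω`. -/
structure HilbertBundle (Ω E : Type*) [TopologicalSpace Ω] [NormedAddCommGroup E]
    [NormedSpace ℂ E] [SMul C₀(Ω, ℂ) E] [CStarModule C₀(Ω, ℂ) E] where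
  base : Ω
  vec : Fibre E base

/-- The bundle topology, generated by the tubes
`{u over U : ‖u - g(π u)‖ < ε}` with `U` open in `Ω`, `g` in `E` and `ε` real. -/
instance : TopologicalSpace (HilbertBundle Ω E) :=
  TopologicalSpace.generateFrom
    {T | ∃ (U : Set Ω) (g : E) (ε : ℝ), IsOpen U ∧
      T = {u : HilbertBundle Ω E | u.base ∈ U ∧ ‖u.vec - eval u.base g‖ < ε}}

variable (Ω) in
/-- `E` is full: the linear span of its inner products is dense in `C₀(Ω)`. -/
def IsFull (E : Type*) [NormedAddCommGroup E] [NormedSpace ℂ E] [SMul C₀(Ω, ℂ) E]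
    [CStarModule C₀(Ω, ℂ) E] : Prop :=
  Dense (Submodule.span ℂ {a : C₀(Ω, ℂ) | ∃ x y : E, a = ⟪x, y⟫_C₀(Ω, ℂ)} : Set C₀(Ω, ℂ))

variable (Ω) in
/-- The support of `x`: the closure of `{ω : x(ω) ≠ 0}` in `Ω`. -/
def supp (x : E) : Set Ω :=
  closure {ω | eval ω x ≠ 0}

variable {Δ : Type*} [TopologicalSpace Δ]
  {F : Type*} [NormedAddCommGroup F] [NormedSpace ℂ F] [SMul C₀(Δ, ℂ) F] [CStarModule C₀(Δ, ℂ) F]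

variable (Ω Δ) in
/-- `⟨x, y⟩ = 0` implies `⟨θ x, θ y⟩ = 0`. -/
def IsOrthogonalityPreserving (θ : E →ₗ[ℂ] F) : Prop :=
  ∀ x y : E, ⟪x, y⟫_C₀(Ω, ℂ) = 0 → ⟪θ x, θ y⟫_C₀(Δ, ℂ) = 0

variable (Ω Δ) in
/-- A linear bijection `θ` is quasi-local if the support of `θ⁻¹(θ(e) a)` lies in that of `e`
for all `e` in `E` and `a` in `C₀(Δ)`. -/
def IsQuasiLocal (θ : E ≃ₗ[ℂ] F) : Prop :=
  ∀ (e : E) (a : C₀(Δ, ℂ)), supp Ω (θ.symm (a • θ e)) ⊆ supp Ω e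

end HilbertC0Module

end

/-! Everything rests on disjointness: two elements are disjoint when at each point one of them
vanishes. Orthogonality alone does not give this, but together with quasi-locality it makes `θ` and
its inverse preserve disjointness (`IsQuasiLocal.isDisjointnessPreserving`).

A disjointness preserving bijection is then localized without any boundedness. For `ν` in `Δ`, call
`U` null if elements vanishing off `U` have images vanishing at `ν`. Compact sets covered by null
neighbourhoods are handled by a partition of unity. An element `e` with `θ e` nonzero at `ν` is cut
into layers where its norm is about `8⁻ⁿ`; completeness of `E` and the gliding hump in
`eval_map_tsum_eq_zero` control the infinite sums. The outcome is a point where `e` itself, and not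
just its support, is nonzero and which has no null neighbourhood. Separating two such points by
disjoint open sets shows that there is only one for each `ν`; this is `σ ν`, and the value of `e`
there determines that of `θ e` at `ν`.

Hence `θ` induces maps of fibres. They preserve orthogonality, so each is a positive multiple `ψ ν`
of a unitary. The closed graph theorem then bounds `θ`, and with it `ψ`. -/

noncomputable section

namespace HilbertC0Module

open Filter Topology

/-! ### Evaluation in the fibres, cutoff functions and disjointness -/

section Basic

variable {Ω : Type*} [TopologicalSpace Ω]
  {E : Type*} [NormedAddCommGroup E] [NormedSpace ℂ E] [SMul C₀(Ω, ℂ) E] [CStarModule C₀(Ω, ℂ) E]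

/-- The inner product of a fibre that comes from its `InnerProductSpace` structure; it is
preferred to the one found through `CStarModule ℂ (Fibre E ω)`. -/
instance instInnerFibre (ω : Ω) : Inner ℂ (Fibre E ω) := InnerProductSpace.toInner

theorem inner_eval_eval (ω : Ω) (x y : E) :
    ⟪eval ω x, eval ω y⟫_ℂ = ⟪x, y⟫_C₀(Ω, ℂ) ω := rfl

variable (E) in
/-- Evaluation at `ω` as a linear map. -/
def evalₗ (ω : Ω) : E →ₗ[ℂ] Fibre E ω where
  toFun := eval ω
  map_add' _ _ := rfl
  map_smul' _ _ := rfl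

theorem eval_add (ω : Ω) (x y : E) : eval ω (x + y) = eval ω x + eval ω y := rfl

theorem eval_sub (ω : Ω) (x y : E) : eval ω (x - y) = eval ω x - eval ω y :=
  map_sub (evalₗ E ω) x y

theorem eval_smul (ω : Ω) (c : ℂ) (x : E) : eval ω (c • x) = c • eval ω x := rfl

theorem eval_sum {ι : Type*} (s : Finset ι) (ω : Ω) (x : ι → E) :
    eval ω (∑ i ∈ s, x i) = ∑ i ∈ s, eval ω (x i) := map_sum (evalₗ E ω) x s

theorem eval_surjective (ω : Ω) : Function.Surjective (eval (E := E) ω) :=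
  Submodule.Quotient.mk_surjective _

@[simp]
theorem eval_smul_zeroAtInfty (ω : Ω) (a : C₀(Ω, ℂ)) (x : E) :
    eval ω (a • x) = a ω • eval ω x := by
  refine ext_inner_left ℂ fun v => ?_
  obtain ⟨y, rfl⟩ := eval_surjective ω v
  rw [inner_smul_right, inner_eval_eval, inner_eval_eval]
  simp

theorem inner_eq_zero_iff {x y : E} :
    ⟪x, y⟫_C₀(Ω, ℂ) = 0 ↔ ∀ ω : Ω, ⟪eval ω x, eval ω y⟫_ℂ = 0 := by
  simp only [inner_eval_eval, DFunLike.ext_iff, ZeroAtInftyContinuousMap.zero_apply]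

variable (Ω) in
theorem ext_eval {x y : E} (h : ∀ ω : Ω, eval ω x = eval ω y) : x = y := by
  rw [← sub_eq_zero, ← CStarModule.inner_self (A := C₀(Ω, ℂ)), inner_eq_zero_iff]
  intro ω
  rw [eval_sub, h, sub_self, inner_zero_left]

theorem norm_apply_le_norm (f : C₀(Ω, ℂ)) (ω : Ω) : ‖f ω‖ ≤ ‖f‖ :=
  f.toBCF.norm_coe_le_norm ω

theorem norm_eval_sq (ω : Ω) (x : E) : ‖eval ω x‖ ^ 2 = ‖⟪x, x⟫_C₀(Ω, ℂ) ω‖ := by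
  rw [← inner_eval_eval, inner_self_eq_norm_sq_to_K]
  simp

theorem norm_eval_le (ω : Ω) (x : E) : ‖eval ω x‖ ≤ ‖x‖ := by
  rw [CStarModule.norm_eq_sqrt_norm_inner_self (A := C₀(Ω, ℂ)) x]
  refine Real.le_sqrt_of_sq_le ?_
  rw [norm_eval_sq]
  exact norm_apply_le_norm _ _

variable (Ω) in
theorem norm_le_of_eval {x : E} {C : ℝ} (hC : 0 ≤ C) (h : ∀ ω : Ω, ‖eval ω x‖ ≤ C) : ‖x‖ ≤ C := by
  rw [CStarModule.norm_eq_sqrt_norm_inner_self (A := C₀(Ω, ℂ)) x]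
  refine Real.sqrt_le_iff.2 ⟨hC, ?_⟩
  rw [← ZeroAtInftyContinuousMap.norm_toBCF_eq_norm, BoundedContinuousFunction.norm_le (sq_nonneg C)]
  intro ω
  have := norm_eval_sq ω x
  change ‖⟪x, x⟫_C₀(Ω, ℂ) ω‖ ≤ _
  rw [← this]
  gcongr
  exact h ω

/-- Evaluation at `ω` as a continuous linear map. -/
def evalL (ω : Ω) : E →L[ℂ] Fibre E ω :=
  (evalₗ E ω).mkContinuous 1 fun x => by rw [one_mul]; exact norm_eval_le ω x

theorem norm_eval_eq_sqrt (ω : Ω) (x : E) : ‖eval ω x‖ = √‖⟪x, x⟫_C₀(Ω, ℂ) ω‖ := by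
  rw [← norm_eval_sq, Real.sqrt_sq (norm_nonneg _)]

theorem continuous_norm_eval (x : E) : Continuous fun ω : Ω => ‖eval ω x‖ := by
  simp only [norm_eval_eq_sqrt]
  fun_prop

theorem tendsto_norm_eval_cocompact (x : E) :
    Tendsto (fun ω : Ω => ‖eval ω x‖) (cocompact Ω) (𝓝 0) := by
  simp only [norm_eval_eq_sqrt]
  have := (Real.continuous_sqrt.comp continuous_norm).tendsto (0 : ℂ)
  simpa using! this.comp (ZeroAtInftyContinuousMap.zero_at_infty' ⟪x, x⟫_C₀(Ω, ℂ))

theorem continuous_inner_eval (x y : E) : Continuous fun ω : Ω => ⟪eval ω x, eval ω y⟫_ℂ := by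
  simp only [inner_eval_eval]
  fun_prop

theorem isCompact_le_norm_eval (x : E) {ε : ℝ} (hε : 0 < ε) :
    IsCompact {ω : Ω | ε ≤ ‖eval ω x‖} := by
  have h := (tendsto_norm_eval_cocompact (Ω := Ω) x).eventually_lt_const hε
  obtain ⟨K, hK, hKs⟩ := mem_cocompact.1 h
  refine hK.of_isClosed_subset (isClosed_le continuous_const (continuous_norm_eval x)) ?_
  intro ω hω
  by_contra hn
  exact (show ε ≤ ‖eval ω x‖ from hω).not_gt (hKs hn)

theorem isOpen_eval_ne_zero (x : E) : IsOpen {ω : Ω | eval ω x ≠ 0} := by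
  have h : {ω : Ω | eval ω x ≠ 0} = {ω : Ω | 0 < ‖eval ω x‖} := by
    ext ω
    exact norm_pos_iff.symm
  rw [h]
  exact isOpen_lt continuous_const (continuous_norm_eval x)

/-- The real function `k ∘ ‖x(·)‖` as an element of `C₀(Ω)`. -/
def normComp (k : ℝ → ℝ) (hk : Continuous k) (h0 : k 0 = 0) (x : E) : C₀(Ω, ℂ) where
  toFun ω := (k ‖eval ω x‖ : ℂ)
  continuous_toFun := by
    have := continuous_norm_eval (Ω := Ω) x
    fun_prop
  zero_at_infty' := by
    have h1 : Continuous fun t : ℝ => (k t : ℂ) := by fun_prop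
    simpa [h0] using! (h1.tendsto 0).comp (tendsto_norm_eval_cocompact (Ω := Ω) x)

theorem normComp_apply (k : ℝ → ℝ) (hk : Continuous k) (h0 : k 0 = 0) (x : E) (ω : Ω) :
    normComp k hk h0 x ω = (k ‖eval ω x‖ : ℂ) := rfl

/-- A compactly supported real function as an element of `C₀(Ω)`. -/
def ofCompactSupport (f : C(Ω, ℝ)) (hf : HasCompactSupport f) : C₀(Ω, ℂ) where
  toFun ω := (f ω : ℂ)
  continuous_toFun := by fun_prop
  zero_at_infty' := by
    have h1 := hf.is_zero_at_infty
    simpa using! (Complex.continuous_ofReal.tendsto 0).comp h1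

theorem ofCompactSupport_apply (f : C(Ω, ℝ)) (hf : HasCompactSupport f) (ω : Ω) :
    ofCompactSupport f hf ω = (f ω : ℂ) := rfl

variable (Ω) in
/-- For all `ω`, one of `x(ω)` and `y(ω)` is zero. -/
def IsDisjoint (x y : E) : Prop := ∀ ω : Ω, eval ω x = 0 ∨ eval ω y = 0

theorem IsDisjoint.symm {x y : E} (h : IsDisjoint Ω x y) : IsDisjoint Ω y x :=
  fun ω => (h ω).symm

theorem IsDisjoint.inner_eq_zero {x y : E} (h : IsDisjoint Ω x y) : ⟪x, y⟫_C₀(Ω, ℂ) = 0 := by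
  rw [inner_eq_zero_iff]
  intro ω
  rcases h ω with h | h <;> simp [h]

/-- The set where an element is nonzero is open, so if it meets the closure of another such set it
already meets the set itself. Passing to closed supports therefore costs nothing. -/
theorem IsDisjoint.of_supp_subset {x x' y y' : E} (h : IsDisjoint Ω x y)
    (hx : supp Ω x' ⊆ supp Ω x) (hy : supp Ω y' ⊆ supp Ω y) : IsDisjoint Ω x' y' := by
  have key : ∀ {u v w : E}, IsDisjoint Ω u v → supp Ω w ⊆ supp Ω u → IsDisjoint Ω w v := by
    intro u v w huv hwu ω
    by_contra! hc
    have h1 : ω ∈ supp Ω u := hwu (subset_closure hc.1)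
    obtain ⟨ω', h2, h3⟩ := mem_closure_iff.1 h1 _ (isOpen_eval_ne_zero v) hc.2
    exact (huv ω').elim h3 h2
  exact (key (key h hx).symm hy).symm

-- Otherwise all inner products would lie in the kernel of evaluation at `ω`, a proper closed
-- subspace of `C₀(Ω)`.
variable (Ω) in
theorem IsFull.exists_eval_ne_zero (hE : IsFull Ω E) [LocallyCompactSpace Ω] [T2Space Ω] (ω : Ω) :
    ∃ x : E, eval ω x ≠ 0 := by
  by_contra! h
  let L : C₀(Ω, ℂ) →ₗ[ℂ] ℂ :=
    { toFun := fun f => f ω, map_add' := fun _ _ => rfl, map_smul' := fun _ _ => rfl }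
  have hL : Continuous L := by
    refine (L.mkContinuous 1 fun f => ?_).continuous
    rw [one_mul]; exact norm_apply_le_norm _ _
  have h1 : (Submodule.span ℂ {a : C₀(Ω, ℂ) | ∃ x y : E, a = ⟪x, y⟫_C₀(Ω, ℂ)} :
      Set C₀(Ω, ℂ)) ⊆ {f | L f = 0} := by
    change Submodule.span ℂ _ ≤ LinearMap.ker L
    rw [Submodule.span_le]
    rintro _ ⟨x, y, rfl⟩
    change ⟪x, y⟫_C₀(Ω, ℂ) ω = 0
    rw [← inner_eval_eval, h x, inner_zero_left]
  have h2 : ∀ f, L f = 0 := fun f =>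
    closure_minimal h1 (isClosed_eq hL continuous_const) (hE f)
  obtain ⟨f, hf, -, hfc, -⟩ := exists_continuous_one_zero_of_isCompact
    (isCompact_singleton (x := ω)) isClosed_empty (Set.disjoint_empty _)
  have := h2 (ofCompactSupport f hfc)
  change ((f ω : ℝ) : ℂ) = 0 at this
  rw [hf rfl] at this
  simp at this

variable (Ω) in
theorem exists_bump [LocallyCompactSpace Ω] [T2Space Ω] {ω : Ω} {U : Set Ω} (hU : U ∈ 𝓝 ω) :
    ∃ a : C₀(Ω, ℂ), a ω = 1 ∧ (∀ ω' ∉ U, a ω' = 0) ∧ ∀ ω', ‖a ω'‖ ≤ 1 := by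
  obtain ⟨V, hVU, hV, hω⟩ := mem_nhds_iff.1 hU
  obtain ⟨f, hf, hf0, hfc, hf1⟩ := exists_continuous_one_zero_of_isCompact
    (isCompact_singleton (x := ω)) hV.isClosed_compl (by simpa using hω)
  refine ⟨ofCompactSupport f hfc, ?_, fun ω' h => ?_, fun ω' => ?_⟩ <;>
    rw [ofCompactSupport_apply]
  · rw [hf rfl]; simp
  · rw [hf0 fun h' => h (hVU h')]; simp
  · rw [Complex.norm_real, Real.norm_of_nonneg (hf1 ω').1]; exact (hf1 ω').2

end Basic

end HilbertC0Module

end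

/-! ### Preservation of disjointness and the gliding hump -/

noncomputable section

namespace HilbertC0Module

open Filter Topology

variable {Ω : Type*} [TopologicalSpace Ω]
  {E : Type*} [NormedAddCommGroup E] [NormedSpace ℂ E] [SMul C₀(Ω, ℂ) E] [CStarModule C₀(Ω, ℂ) E]
  {Δ : Type*} [TopologicalSpace Δ]
  {F : Type*} [NormedAddCommGroup F] [NormedSpace ℂ F] [SMul C₀(Δ, ℂ) F] [CStarModule C₀(Δ, ℂ) F]

variable (Ω Δ) in
/-- `θ` maps disjoint elements to disjoint elements. -/
def IsDisjointnessPreserving (θ : E →ₗ[ℂ] F) : Prop :=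
  ∀ x y : E, IsDisjoint Ω x y → IsDisjoint Δ (θ x) (θ y)

theorem IsQuasiLocal.isDisjointnessPreserving {θ : E ≃ₗ[ℂ] F} (hql : IsQuasiLocal Ω Δ θ)
    (hop : IsOrthogonalityPreserving Ω Δ (θ : E →ₗ[ℂ] F))
    (hop' : IsOrthogonalityPreserving Δ Ω (θ.symm : F →ₗ[ℂ] E)) :
    IsDisjointnessPreserving Ω Δ (θ : E →ₗ[ℂ] F) := by
  intro e g heg
  have hfh := inner_eq_zero_iff.1 (hop e g heg.inner_eq_zero)
  have hhf := inner_eq_zero_iff.1 (hop g e heg.symm.inner_eq_zero)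
  simp only [LinearEquiv.coe_coe] at hfh hhf ⊢
  set f := θ e with hf
  set h := θ g with hh
  set p := ⟪f, f⟫_C₀(Δ, ℂ) with hp
  set q := ⟪h, h⟫_C₀(Δ, ℂ) with hq
  have hu : supp Ω (θ.symm (q • f)) ⊆ supp Ω e := hql e q
  have hv : supp Ω (θ.symm (p • h)) ⊆ supp Ω g := hql g p
  -- As `f` and `h` are orthogonal, only `q⟨f, f⟩ - p⟨h, h⟩ = qp - pq` is left. The weights `p`, `q`
  -- are what quasi-locality permits.
  have h1 : ⟪f + h, q • f - p • h⟫_C₀(Δ, ℂ) = 0 := by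
    rw [inner_eq_zero_iff]
    intro ν
    have hpν : ⟪eval ν f, eval ν f⟫_ℂ = p ν := rfl
    have hqν : ⟪eval ν h, eval ν h⟫_ℂ = q ν := rfl
    rw [eval_add, eval_sub, eval_smul_zeroAtInfty, eval_smul_zeroAtInfty, inner_add_left,
      inner_sub_right, inner_sub_right, inner_smul_right, inner_smul_right, inner_smul_right,
      inner_smul_right, hfh, hhf, hpν, hqν]
    ring
  have h2 := inner_eq_zero_iff.1 (hop' _ _ h1)
  -- By quasi-locality the cross terms of `h2` vanish, leaving `⟨e, θ⁻¹(q f)⟩ = ⟨g, θ⁻¹(p h)⟩`. One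
  -- side lives where `e` is nonzero, the other where `g` is, so both are zero. Applying `θ` gives
  -- `q p = 0`.
  have h3 : ⟪e, θ.symm (q • f)⟫_C₀(Ω, ℂ) = 0 := by
    rw [inner_eq_zero_iff]
    intro ω
    have h4 := h2 ω
    simp only [LinearEquiv.coe_coe, map_add, map_sub, hf, hh, LinearEquiv.symm_apply_apply] at h4
    simp only [← hf, ← hh] at h4
    have h5 := inner_eq_zero_iff.1 (heg.of_supp_subset subset_rfl hv).inner_eq_zero ω
    have h6 := inner_eq_zero_iff.1 (heg.symm.of_supp_subset subset_rfl hu).inner_eq_zero ω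
    rw [eval_add, eval_sub, inner_add_left, inner_sub_right, inner_sub_right, h5, h6] at h4
    rcases heg ω with h7 | h7
    · rw [h7, inner_zero_left]
    · rw [h7, inner_zero_left] at h4
      simpa using h4
  have h8 := inner_eq_zero_iff.1 (hop _ _ h3)
  intro ν
  have h9 := h8 ν
  simp only [LinearEquiv.coe_coe, LinearEquiv.apply_symm_apply, ← hf] at h9
  rw [eval_smul_zeroAtInfty, inner_smul_right, mul_eq_zero] at h9
  rcases h9 with h9 | h9
  · right
    rw [hq, ← inner_eval_eval] at h9
    exact inner_self_eq_zero.1 h9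
  · left
    exact inner_self_eq_zero.1 h9

theorem eval_tsum_of_pairwise_isDisjoint {h : ℕ → E}
    (hd : Pairwise fun n m => IsDisjoint Ω (h n) (h m)) {c : ℕ → ℂ}
    (hs : Summable fun n => c n • h n) {n : ℕ} {ω : Ω} (hn : eval ω (h n) ≠ 0) :
    eval ω (∑' n, c n • h n) = c n • eval ω (h n) := by
  have h1 : eval ω (∑' n, c n • h n) = ∑' n, c n • eval ω (h n) :=
    (evalL (E := E) ω).map_tsum hs
  rw [h1, tsum_eq_single n]
  intro m hm
  rw [((hd hm.symm) ω).resolve_left hn, smul_zero]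

variable [LocallyCompactSpace Δ] [T2Space Δ] [CompleteSpace E]

/-- If the `hₙ` are pairwise disjoint and of norm `O(4⁻ⁿ)` and if each `θ hₙ` vanishes near `ν`,
then `θ (∑ hₙ)` vanishes at `ν`: otherwise `θ (∑ 2ⁿ hₙ)` would be unbounded near `ν`. -/
theorem eval_map_tsum_eq_zero {θ : E ≃ₗ[ℂ] F}
    (hθ : IsDisjointnessPreserving Ω Δ (θ : E →ₗ[ℂ] F))
    (hθ' : IsDisjointnessPreserving Δ Ω (θ.symm : F →ₗ[ℂ] E))
    {h : ℕ → E} (hd : Pairwise fun n m => IsDisjoint Ω (h n) (h m)) {C : ℝ}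
    (hC : ∀ n, ‖h n‖ ≤ C * (1 / 4) ^ n) {ν : Δ} (hν : ∀ n, ∀ᶠ ν' in 𝓝 ν, eval ν' (θ (h n)) = 0) :
    eval ν (θ (∑' n, h n)) = 0 := by
  have hs1 : Summable h := Summable.of_norm_bounded
    ((summable_geometric_of_lt_one (by norm_num) (by norm_num : (1 / 4 : ℝ) < 1)).mul_left C) hC
  have hs1' : Summable fun n => (1 : ℂ) • h n := by simpa using hs1
  have hs2 : Summable fun n => (2 : ℂ) ^ n • h n := by
    refine Summable.of_norm_bounded (g := fun n : ℕ => C * (1 / 2) ^ n)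
      ((summable_geometric_of_lt_one (by norm_num) (by norm_num : (1 / 2 : ℝ) < 1)).mul_left C)
      fun n => ?_
    rw [norm_smul, norm_pow, Complex.norm_ofNat]
    calc (2 : ℝ) ^ n * ‖h n‖ ≤ 2 ^ n * (C * (1 / 4) ^ n) := by gcongr; exact hC n
      _ = C * (1 / 2) ^ n := by
        rw [mul_left_comm, ← mul_pow]; norm_num
  set x := ∑' n, h n with hx
  have hx' : x = ∑' n, (1 : ℂ) • h n := by simp [hx]
  set g := ∑' n, (2 : ℂ) ^ n • h n with hg
  -- Where `h n` is nonzero the other terms vanish, so `g = 2ⁿ x` there.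
  have hgx : ∀ n, IsDisjoint Ω (h n) (g - (2 : ℂ) ^ n • x) := by
    intro n ω
    by_cases hn : eval ω (h n) = 0
    · exact Or.inl hn
    · right
      rw [eval_sub, eval_smul, hg, hx', eval_tsum_of_pairwise_isDisjoint hd hs2 hn,
        eval_tsum_of_pairwise_isDisjoint hd hs1' hn, one_smul, sub_self]
  by_contra hne
  have hpos : 0 < ‖eval ν (θ x)‖ := norm_pos_iff.2 hne
  set δ := ‖eval ν (θ x)‖ / 2
  have hδ : 0 < δ := by positivity
  set M := ‖eval ν (θ g)‖ + 1
  obtain ⟨N, hN⟩ := pow_unbounded_of_one_lt (M / δ) (one_lt_two : (1 : ℝ) < 2)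
  have hW : ∀ᶠ ν' in 𝓝 ν, (δ < ‖eval ν' (θ x)‖ ∧ ‖eval ν' (θ g)‖ < M) ∧
      ∀ n < N, eval ν' (θ (h n)) = 0 := by
    refine (((continuous_norm_eval _).tendsto ν).eventually_const_lt (half_lt_self hpos)).and
      (((continuous_norm_eval _).tendsto ν).eventually_lt_const (lt_add_one _)) |>.and ?_
    exact (Set.finite_lt_nat N).eventually_all.2 fun n _ => hν n
  -- One neighbourhood serves all `n`: a nonzero `θ (h n)` at `ν'` forces `n ≥ N` and `θ g = 2ⁿ θ x`
  -- at `ν'`, of norm at least `2ᴺ δ > M`.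
  have hzero : ∀ᶠ ν' in 𝓝 ν, ∀ n, eval ν' (θ (h n)) = 0 := by
    filter_upwards [hW] with ν' ⟨⟨h1, h2⟩, h3⟩ n
    by_contra hn
    have hNn : N ≤ n := by
      by_contra! hlt
      exact hn (h3 n hlt)
    have h4 := (hθ _ _ (hgx n) ν').resolve_left hn
    simp only [LinearEquiv.coe_coe, map_sub, map_smul] at h4
    rw [eval_sub, eval_smul, sub_eq_zero] at h4
    rw [h4, norm_smul, norm_pow, Complex.norm_ofNat] at h2
    have h5 : (2 : ℝ) ^ N ≤ 2 ^ n := pow_le_pow_right₀ one_le_two hNn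
    rw [div_lt_iff₀ hδ] at hN
    have : (2 : ℝ) ^ N * δ ≤ 2 ^ n * ‖eval ν' (θ x)‖ := by gcongr
    linarith
  obtain ⟨a, ha, ha0, -⟩ := exists_bump Δ hzero
  have hf : ∀ n, IsDisjoint Δ (a • θ x) (θ (h n)) := by
    intro n ν'
    rw [eval_smul_zeroAtInfty]
    by_cases h : ν' ∈ {ν' | ∀ n, eval ν' (θ (h n)) = 0}
    · exact Or.inr (h n)
    · left; rw [ha0 ν' h, zero_smul]
  -- The preimage of `a • θ x` is disjoint from every `h n`, hence from their sum `x`. Mapping back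
  -- makes `a • θ x` disjoint from `θ x`, which is absurd at `ν`.
  have hk : IsDisjoint Ω (θ.symm (a • θ x)) x := by
    intro ω
    by_contra! hc
    have h1 : ∀ n, eval ω (h n) = 0 := by
      intro n
      have := hθ' _ _ (hf n) ω
      simp only [LinearEquiv.coe_coe, LinearEquiv.symm_apply_apply] at this
      exact this.resolve_left hc.1
    apply hc.2
    have h2 : eval ω x = ∑' n, eval ω (h n) := (evalL (E := E) ω).map_tsum hs1
    rw [h2]
    simp [h1]
  have := hθ _ _ hk ν
  simp only [LinearEquiv.coe_coe, LinearEquiv.apply_symm_apply] at this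
  rw [eval_smul_zeroAtInfty, ha, one_smul, or_self] at this
  exact hne this

end HilbertC0Module

end

/-! ### Localization: each point of `Δ` sees a single point of `Ω` -/

noncomputable section

namespace HilbertC0Module

open Filter Topology

variable {Ω : Type*} [TopologicalSpace Ω]
  {E : Type*} [NormedAddCommGroup E] [NormedSpace ℂ E] [SMul C₀(Ω, ℂ) E] [CStarModule C₀(Ω, ℂ) E]
  {Δ : Type*} [TopologicalSpace Δ]
  {F : Type*} [NormedAddCommGroup F] [NormedSpace ℂ F] [SMul C₀(Δ, ℂ) F] [CStarModule C₀(Δ, ℂ) F]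

/-- The values of `θ` at `ν` do not see the elements supported in `U`. -/
def IsNullSet (θ : E ≃ₗ[ℂ] F) (ν : Δ) (U : Set Ω) : Prop :=
  ∀ x : E, (∀ ω ∉ U, eval ω x = 0) → eval ν (θ x) = 0

/-- A partition of unity removes from `e` its part over `K` without changing the image at `ν`. What
remains is disjoint from `x` and has nonzero image near `ν`, so `θ x` must vanish there. -/
theorem IsNullSet.eventually_eval_eq_zero [LocallyCompactSpace Ω] [T2Space Ω] {θ : E ≃ₗ[ℂ] F}
    (hθ : IsDisjointnessPreserving Ω Δ (θ : E →ₗ[ℂ] F)) {ν : Δ} {e : E} (he : eval ν (θ e) ≠ 0)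
    {K : Set Ω} (hK : IsCompact K) (hKn : ∀ ω ∈ K, ∃ U ∈ 𝓝 ω, IsNullSet θ ν U)
    {x : E} (hx : ∀ ω ∉ K, eval ω x = 0) : ∀ᶠ ν' in 𝓝 ν, eval ν' (θ x) = 0 := by
  choose! U hU hUn using hKn
  obtain ⟨t, htK, ht⟩ := hK.elim_nhds_subcover (fun ω => interior (U ω))
    fun ω hω => interior_mem_nhds.2 (hU ω hω)
  obtain ⟨f, hfs, hf1, -, hfc⟩ := exists_continuous_sum_one_of_isOpen_isCompact
    (s := fun i => interior (U (t.equivFin.symm i : Ω))) (fun i => isOpen_interior) hK (by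
      intro ω hω
      obtain ⟨j, hj, hωj⟩ := Set.mem_iUnion₂.1 (ht hω)
      exact Set.mem_iUnion.2 ⟨t.equivFin ⟨j, hj⟩, by simpa using hωj⟩)
  have hb : ∀ i, eval ν (θ (ofCompactSupport (f i) (hfc i) • e)) = 0 := by
    intro i
    refine hUn _ (htK _ (t.equivFin.symm i).2) _ fun ω hω => ?_
    have h0 : f i ω = 0 := by
      by_contra h
      exact hω (interior_subset (hfs i (subset_tsupport _ h)))
    rw [eval_smul_zeroAtInfty, ofCompactSupport_apply, h0, Complex.ofReal_zero, zero_smul]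
  set y := e - ∑ i, ofCompactSupport (f i) (hfc i) • e with hy
  have hyν : eval ν (θ y) ≠ 0 := by
    rw [hy, map_sub, map_sum, eval_sub, eval_sum, Finset.sum_eq_zero fun i _ => hb i, sub_zero]
    exact he
  have hyx : IsDisjoint Ω y x := by
    intro ω
    by_cases hω : ω ∈ K
    · left
      have h1 : ∑ i, f i ω = 1 := by simpa using hf1 hω
      rw [hy, eval_sub, eval_sum]
      simp only [eval_smul_zeroAtInfty, ofCompactSupport_apply]
      rw [← Finset.sum_smul, ← Complex.ofReal_sum, h1, Complex.ofReal_one, one_smul, sub_self]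
    · exact Or.inr (hx ω hω)
  filter_upwards [(isOpen_eval_ne_zero (θ y)).mem_nhds hyν] with ν' hν'
  exact (hθ _ _ hyx ν').resolve_left hν'

/-- A continuous cutoff that is `0` on `t ≤ 8⁻ⁿ` and `1` on `t ≥ 8 · 8⁻ⁿ`. -/
def cutoff (n : ℕ) (t : ℝ) : ℝ := max 0 (min 1 ((8 ^ n * t - 1) / 7))

theorem continuous_cutoff (n : ℕ) : Continuous (cutoff n) := by
  unfold cutoff; fun_prop

theorem cutoff_of_le {n : ℕ} {t : ℝ} (h : 8 ^ n * t ≤ 1) : cutoff n t = 0 :=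
  max_eq_left ((min_le_right _ _).trans (by linarith))

theorem cutoff_of_ge {n : ℕ} {t : ℝ} (h : 8 ≤ 8 ^ n * t) : cutoff n t = 1 := by
  rw [cutoff, min_eq_left (by linarith), max_eq_right zero_le_one]

theorem cutoff_zero_right (n : ℕ) : cutoff n 0 = 0 := cutoff_of_le (by simp)

theorem cutoff_mem (n : ℕ) (t : ℝ) : cutoff n t ∈ Set.Icc (0 : ℝ) 1 :=
  ⟨le_max_left _ _, max_le zero_le_one (min_le_left _ _)⟩

/-- The part of `e` where `‖e(·)‖` exceeds `8⁻ⁿ`. -/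
def truncate (n : ℕ) (e : E) : E :=
  normComp (Ω := Ω) (cutoff n) (continuous_cutoff n) (cutoff_zero_right n) e • e

theorem eval_truncate (n : ℕ) (e : E) (ω : Ω) :
    eval ω (truncate (Ω := Ω) n e) = (cutoff n ‖eval ω e‖ : ℂ) • eval ω e := by
  rw [truncate, eval_smul_zeroAtInfty, normComp_apply]

theorem norm_sub_truncate_le (n : ℕ) (e : E) :
    ‖e - truncate (Ω := Ω) n e‖ ≤ 8 * (1 / 8) ^ n := by
  refine norm_le_of_eval Ω (by positivity) fun ω => ?_
  rw [eval_sub, eval_truncate]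
  nth_rw 1 [← one_smul ℂ (eval ω e)]
  rw [← sub_smul, norm_smul, ← Complex.ofReal_one, ← Complex.ofReal_sub, Complex.norm_real]
  obtain ⟨h0, h1⟩ := cutoff_mem n ‖eval ω e‖
  rw [Real.norm_of_nonneg (by linarith)]
  rcases le_total 8 (8 ^ n * ‖eval ω e‖) with h | h
  · rw [cutoff_of_ge h, sub_self, zero_mul]; positivity
  · calc (1 - cutoff n ‖eval ω e‖) * ‖eval ω e‖ ≤ 1 * ‖eval ω e‖ := by gcongr; linarith
      _ = (8 ^ n * ‖eval ω e‖) * (1 / 8) ^ n := by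
        rw [mul_right_comm, ← mul_pow]; norm_num
      _ ≤ 8 * (1 / 8) ^ n := by gcongr

/-- The part of `e` where `‖e(·)‖` is of the order of `8⁻ⁿ`. -/
def layer (n : ℕ) (e : E) : E := truncate (Ω := Ω) (n + 1) e - truncate (Ω := Ω) n e

theorem eval_layer (n : ℕ) (e : E) (ω : Ω) : eval ω (layer (Ω := Ω) n e) =
    ((cutoff (n + 1) ‖eval ω e‖ - cutoff n ‖eval ω e‖ : ℝ) : ℂ) • eval ω e := by
  rw [layer, eval_sub, eval_truncate, eval_truncate, ← sub_smul, Complex.ofReal_sub]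

theorem eval_layer_of_le {n : ℕ} {e : E} {ω : Ω} (h : 8 ^ (n + 1) * ‖eval ω e‖ ≤ 1) :
    eval ω (layer (Ω := Ω) n e) = 0 := by
  have h' : 8 ^ n * ‖eval ω e‖ ≤ 1 := le_trans (by gcongr <;> simp) h
  rw [eval_layer, cutoff_of_le h, cutoff_of_le h', sub_self, Complex.ofReal_zero, zero_smul]

theorem eval_layer_of_ge {n : ℕ} {e : E} {ω : Ω} (h : 8 ≤ 8 ^ n * ‖eval ω e‖) :
    eval ω (layer (Ω := Ω) n e) = 0 := by
  have h' : 8 ≤ 8 ^ (n + 1) * ‖eval ω e‖ := le_trans h (by gcongr <;> simp)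
  rw [eval_layer, cutoff_of_ge h, cutoff_of_ge h', sub_self, Complex.ofReal_zero, zero_smul]

/-- Layer `n` lives where `8⁻ⁿ⁻¹ < ‖e(ω)‖ < 8¹⁻ⁿ`, so only consecutive layers overlap; the even and
the odd layers each form a pairwise disjoint family. -/
theorem isDisjoint_layer {n m : ℕ} (h : n + 2 ≤ m) (e : E) :
    IsDisjoint Ω (layer (Ω := Ω) n e) (layer (Ω := Ω) m e) := by
  intro ω
  rcases le_total (8 ^ (n + 1) * ‖eval ω e‖) 1 with h1 | h1
  · exact Or.inl (eval_layer_of_le h1)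
  · right
    refine eval_layer_of_ge ?_
    calc (8 : ℝ) ≤ 8 * (8 ^ (n + 1) * ‖eval ω e‖) := by linarith
      _ = 8 ^ (n + 2) * ‖eval ω e‖ := by ring
      _ ≤ 8 ^ m * ‖eval ω e‖ := by gcongr; norm_num

theorem norm_layer_le (n : ℕ) (e : E) : ‖layer (Ω := Ω) n e‖ ≤ 16 * (1 / 8) ^ n := by
  have h : layer (Ω := Ω) n e =
      (e - truncate (Ω := Ω) n e) - (e - truncate (Ω := Ω) (n + 1) e) := by
    rw [layer]; abel
  rw [h]
  refine (norm_sub_le _ _).trans ?_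
  have h1 := norm_sub_truncate_le (Ω := Ω) n e
  have h2 := norm_sub_truncate_le (Ω := Ω) (n + 1) e
  have h3 : (0 : ℝ) < (1 / 8) ^ n := by positivity
  rw [pow_succ] at h2
  linarith

theorem summable_layer [CompleteSpace E] (e : E) : Summable fun n => layer (Ω := Ω) n e :=
  Summable.of_norm_bounded ((summable_geometric_of_lt_one (by norm_num)
    (by norm_num : (1 / 8 : ℝ) < 1)).mul_left 16) fun n => norm_layer_le n e

theorem tsum_layer [CompleteSpace E] (e : E) :
    ∑' n, layer (Ω := Ω) n e = e - truncate (Ω := Ω) 0 e := by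
  refine ((summable_layer e).hasSum_iff_tendsto_nat.2 ?_).tsum_eq
  simp only [layer, Finset.sum_range_sub (fun n => truncate (Ω := Ω) n e)]
  refine Tendsto.sub_const ?_ _
  rw [tendsto_iff_norm_sub_tendsto_zero]
  refine squeeze_zero (g := fun n : ℕ => 8 * (1 / 8 : ℝ) ^ n) (fun _ => norm_nonneg _)
    (fun n => by rw [norm_sub_rev]; exact norm_sub_truncate_le n e) ?_
  simpa using (tendsto_pow_atTop_nhds_zero_of_lt_one (by norm_num)
    (by norm_num : (1 / 8 : ℝ) < 1)).const_mul 8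

variable [LocallyCompactSpace Ω] [T2Space Ω] [LocallyCompactSpace Δ] [T2Space Δ] [CompleteSpace E]

theorem exists_eval_ne_zero_not_isNullSet {θ : E ≃ₗ[ℂ] F}
    (hθ : IsDisjointnessPreserving Ω Δ (θ : E →ₗ[ℂ] F))
    (hθ' : IsDisjointnessPreserving Δ Ω (θ.symm : F →ₗ[ℂ] E)) {ν : Δ} {e : E}
    (he : eval ν (θ e) ≠ 0) :
    ∃ ω : Ω, eval ω e ≠ 0 ∧ ∀ U ∈ 𝓝 ω, ¬ IsNullSet θ ν U := by
  by_contra! hcon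
  -- The set `‖e(ω)‖ ≥ 8⁻ⁿ` is compact, and by `hcon` each of its points has a null neighbourhood.
  have hsmall : ∀ n : ℕ, ∀ x : E, (∀ ω : Ω, 8 ^ n * ‖eval ω e‖ ≤ 1 → eval ω x = 0) →
      ∀ᶠ ν' in 𝓝 ν, eval ν' (θ x) = 0 := by
    intro n x hx
    have hε : (0 : ℝ) < (1 / 8) ^ n := by positivity
    refine IsNullSet.eventually_eval_eq_zero hθ he (isCompact_le_norm_eval e hε)
      (fun ω hω => hcon ω (norm_pos_iff.1 (hε.trans_le hω))) fun ω hω => hx ω ?_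
    have h1 : ‖eval ω e‖ < (1 / 8) ^ n := not_le.1 hω
    calc (8 : ℝ) ^ n * ‖eval ω e‖ ≤ 8 ^ n * (1 / 8) ^ n := by gcongr
      _ = 1 := by rw [← mul_pow]; norm_num
  have hlayer : ∀ n, ∀ᶠ ν' in 𝓝 ν, eval ν' (θ (layer (Ω := Ω) n e)) = 0 := fun n =>
    hsmall (n + 1) _ fun ω hω => eval_layer_of_le hω
  have hpart : ∀ j : ℕ, eval ν (θ (∑' n, layer (Ω := Ω) (2 * n + j) e)) = 0 := by
    intro j
    refine eval_map_tsum_eq_zero hθ hθ' ?_ (C := 16) ?_ fun n => hlayer _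
    · intro n m hnm
      rcases lt_or_gt_of_ne hnm with h | h
      · exact isDisjoint_layer (by omega) e
      · exact (isDisjoint_layer (by omega) e).symm
    · intro n
      refine (norm_layer_le _ e).trans ?_
      gcongr 16 * ?_
      calc (1 / 8 : ℝ) ^ (2 * n + j) ≤ (1 / 8) ^ n :=
            pow_le_pow_of_le_one (by norm_num) (by norm_num) (by omega)
        _ ≤ (1 / 4) ^ n := by gcongr; norm_num
  have hs := summable_layer (Ω := Ω) e
  have hsum := tsum_even_add_odd (f := fun n => layer (Ω := Ω) n e)
    (hs.comp_injective (i := fun k => 2 * k) fun a b h => by simpa using h)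
    (hs.comp_injective (i := fun k => 2 * k + 1) fun a b h => by simpa using h)
  rw [tsum_layer] at hsum
  have h0 : eval ν (θ (truncate (Ω := Ω) 0 e)) = 0 := by
    refine (hsmall 0 _ fun ω hω => ?_).self_of_nhds
    rw [eval_truncate, cutoff_of_le hω, Complex.ofReal_zero, zero_smul]
  have h1 := hpart 0
  have h2 := hpart 1
  simp only [add_zero] at h1
  have h3 : eval ν (θ (e - truncate (Ω := Ω) 0 e)) = 0 := by
    rw [← hsum, map_add, eval_add, h1, h2, add_zero]
  rw [map_sub, eval_sub, h0, sub_zero] at h3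
  exact he h3

/-- The values of `θ e` at `ν` depend on the value of `e` at a single point only. -/
theorem exists_forall_eval_map_eq_zero (hF : IsFull Δ F) {θ : E ≃ₗ[ℂ] F}
    (hθ : IsDisjointnessPreserving Ω Δ (θ : E →ₗ[ℂ] F))
    (hθ' : IsDisjointnessPreserving Δ Ω (θ.symm : F →ₗ[ℂ] E)) (ν : Δ) :
    ∃ ω : Ω, ∀ e : E, eval ω e = 0 → eval ν (θ e) = 0 := by
  obtain ⟨f, hf⟩ := hF.exists_eval_ne_zero Δ ν
  obtain ⟨ω, -, hω⟩ := exists_eval_ne_zero_not_isNullSet hθ hθ' (e := θ.symm f)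
    (by rwa [LinearEquiv.apply_symm_apply])
  refine ⟨ω, fun e he => ?_⟩
  by_contra hne
  obtain ⟨ω', hω'e, hω'⟩ := exists_eval_ne_zero_not_isNullSet hθ hθ' hne
  -- This uses that `e` is nonzero at `ω'` itself; a point of the support would not do.
  have hne' : ω ≠ ω' := by rintro rfl; exact hω'e he
  obtain ⟨U, V, hU, hV, hUω, hVω', hUV⟩ := t2_separation hne'
  have h1 := hω U (hU.mem_nhds hUω)
  have h2 := hω' V (hV.mem_nhds hVω')
  simp only [IsNullSet, not_forall] at h1 h2
  obtain ⟨x, hx, hxν⟩ := h1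
  obtain ⟨y, hy, hyν⟩ := h2
  have hxy : IsDisjoint Ω x y := by
    intro ω''
    by_cases h : ω'' ∈ U
    · exact Or.inr (hy _ (Set.disjoint_left.1 hUV h))
    · exact Or.inl (hx _ h)
  exact (hθ _ _ hxy ν).elim hxν hyν

end HilbertC0Module

end

/-! ### Orthogonality preserving maps of fibres, and continuity -/

noncomputable section

section OrthogonalityPreserving

variable {𝕜 V W : Type*} [RCLike 𝕜] [NormedAddCommGroup V] [InnerProductSpace 𝕜 V]
  [NormedAddCommGroup W] [InnerProductSpace 𝕜 W]

/-- Scaled to equal length, orthogonal vectors have orthogonal sum and difference; orthogonality of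
the images of these forces equal lengths. -/
theorem LinearMap.norm_mul_norm_map_eq_of_inner_eq_zero (T : V →ₗ[𝕜] W)
    (hT : ∀ x y, ⟪x, y⟫_𝕜 = 0 → ⟪T x, T y⟫_𝕜 = 0) {x y : V} (hxy : ⟪x, y⟫_𝕜 = 0) :
    ‖y‖ * ‖T x‖ = ‖x‖ * ‖T y‖ := by
  have hyx : ⟪y, x⟫_𝕜 = 0 := inner_eq_zero_symm.1 hxy
  have h1 : ⟪(‖y‖ : 𝕜) • x + (‖x‖ : 𝕜) • y, (‖y‖ : 𝕜) • x - (‖x‖ : 𝕜) • y⟫_𝕜 = 0 := by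
    simp only [inner_add_left, inner_sub_right, inner_smul_left, inner_smul_right, hxy, hyx,
      inner_self_eq_norm_sq_to_K, RCLike.conj_ofReal]
    ring
  have h2 := hT _ _ h1
  simp only [map_add, map_sub, map_smul, inner_add_left, inner_sub_right, inner_smul_left,
    inner_smul_right, hT _ _ hxy, hT _ _ hyx, inner_self_eq_norm_sq_to_K, RCLike.conj_ofReal] at h2
  have h3 : (‖y‖ * ‖T x‖) ^ 2 = (‖x‖ * ‖T y‖) ^ 2 := by
    have h4 : (((‖y‖ * ‖T x‖) ^ 2 - (‖x‖ * ‖T y‖) ^ 2 : ℝ) : 𝕜) = 0 := by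
      push_cast
      linear_combination h2
    exact sub_eq_zero.1 (RCLike.ofReal_eq_zero.1 h4)
  exact (sq_eq_sq₀ (by positivity) (by positivity)).1 h3

theorem LinearMap.exists_norm_map_eq_mul_norm (T : V →ₗ[𝕜] W)
    (hT : ∀ x y, ⟪x, y⟫_𝕜 = 0 → ⟪T x, T y⟫_𝕜 = 0) : ∃ c : ℝ, 0 ≤ c ∧ ∀ x, ‖T x‖ = c * ‖x‖ := by
  by_cases h : ∃ x₀ : V, x₀ ≠ 0
  · obtain ⟨x₀, hx₀⟩ := h
    have hpos : 0 < ‖x₀‖ := norm_pos_iff.2 hx₀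
    refine ⟨‖T x₀‖ / ‖x₀‖, by positivity, fun y => ?_⟩
    set α : 𝕜 := ⟪x₀, y⟫_𝕜 / ⟪x₀, x₀⟫_𝕜
    set z := y - α • x₀ with hz
    have hy : y = α • x₀ + z := by rw [hz]; abel
    have hxz : ⟪x₀, z⟫_𝕜 = 0 := by
      rw [hz, inner_sub_right, inner_smul_right, div_mul_cancel₀ _ (inner_self_ne_zero.2 hx₀),
        sub_self]
    have h1 : ‖y‖ * ‖y‖ = ‖α • x₀‖ * ‖α • x₀‖ + ‖z‖ * ‖z‖ := by
      rw [hy]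
      exact norm_add_sq_eq_norm_sq_add_norm_sq_of_inner_eq_zero _ _
        (by rw [inner_smul_left, hxz, mul_zero])
    have h2 : ‖T y‖ * ‖T y‖ = ‖α • T x₀‖ * ‖α • T x₀‖ + ‖T z‖ * ‖T z‖ := by
      rw [hy, map_add, map_smul]
      exact norm_add_sq_eq_norm_sq_add_norm_sq_of_inner_eq_zero _ _
        (by rw [inner_smul_left, hT _ _ hxz, mul_zero])
    have h3 : ‖T z‖ = ‖T x₀‖ / ‖x₀‖ * ‖z‖ := by
      have := T.norm_mul_norm_map_eq_of_inner_eq_zero hT hxz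
      field_simp
      linarith
    refine (mul_self_inj (norm_nonneg _) (by positivity)).1 ?_
    rw [h2, h3, mul_mul_mul_comm _ ‖y‖, h1, norm_smul, norm_smul]
    field_simp
  · push Not at h
    exact ⟨0, le_rfl, fun x => by rw [h x]; simp⟩

end OrthogonalityPreserving

namespace HilbertC0Module

open Filter Topology

variable {Ω : Type*} [TopologicalSpace Ω]
  {E : Type*} [NormedAddCommGroup E] [NormedSpace ℂ E] [SMul C₀(Ω, ℂ) E] [CStarModule C₀(Ω, ℂ) E]
  {Δ : Type*} [TopologicalSpace Δ]
  {F : Type*} [NormedAddCommGroup F] [NormedSpace ℂ F] [SMul C₀(Δ, ℂ) F] [CStarModule C₀(Δ, ℂ) F]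

/-- The map of fibres induced by a linear map. -/
def fibreMap (θ : E →ₗ[ℂ] F) (ω : Ω) (ν : Δ) (h : ∀ e : E, eval ω e = 0 → eval ν (θ e) = 0) :
    Fibre E ω →ₗ[ℂ] Fibre F ν :=
  have key : ∀ x y : E, eval ω x = eval ω y → eval ν (θ x) = eval ν (θ y) := fun x y hxy => by
    rw [← sub_eq_zero, ← eval_sub, ← map_sub]
    exact h _ (by rw [eval_sub, hxy, sub_self])
  { toFun := fun u => eval ν (θ (Function.surjInv (eval_surjective ω) u))
    map_add' := fun u v => by
      rw [← eval_add, ← map_add]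
      apply key
      rw [eval_add]
      simp only [Function.surjInv_eq]
    map_smul' := fun c u => by
      rw [RingHom.id_apply, ← eval_smul, ← map_smul]
      apply key
      rw [eval_smul]
      simp only [Function.surjInv_eq] }

theorem fibreMap_eval (θ : E →ₗ[ℂ] F) (ω : Ω) (ν : Δ)
    (h : ∀ e : E, eval ω e = 0 → eval ν (θ e) = 0) (e : E) :
    fibreMap θ ω ν h (eval ω e) = eval ν (θ e) := by
  change eval ν (θ (Function.surjInv (eval_surjective ω) (eval ω e))) = _
  rw [← sub_eq_zero, ← eval_sub, ← map_sub]
  exact h _ (by rw [eval_sub, Function.surjInv_eq (eval_surjective ω), sub_self])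

/-- Lifts of orthogonal fibre vectors need not be orthogonal over all of `Ω`. A Gram–Schmidt step
without division, `p g - q e`, makes them so and only rescales the value at `ω` by `p ω ≠ 0`. -/
theorem inner_fibreMap_eq_zero {θ : E →ₗ[ℂ] F} (hop : IsOrthogonalityPreserving Ω Δ θ) {ω : Ω}
    {ν : Δ} (h : ∀ e : E, eval ω e = 0 → eval ν (θ e) = 0) (u v : Fibre E ω)
    (huv : ⟪u, v⟫_ℂ = 0) : ⟪fibreMap θ ω ν h u, fibreMap θ ω ν h v⟫_ℂ = 0 := by
  by_cases hu : u = 0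
  · rw [hu, map_zero, inner_zero_left]
  obtain ⟨e, rfl⟩ := eval_surjective ω u
  obtain ⟨g, rfl⟩ := eval_surjective ω v
  set p := ⟪e, e⟫_C₀(Ω, ℂ) with hp
  set q := ⟪e, g⟫_C₀(Ω, ℂ) with hq
  have h1 : ⟪e, p • g - q • e⟫_C₀(Ω, ℂ) = 0 := by
    rw [CStarModule.inner_sub_right, CStarModule.inner_op_smul_right,
      CStarModule.inner_op_smul_right, ← hp, ← hq, mul_comm, sub_self]
  have h2 := inner_eq_zero_iff.1 (hop _ _ h1) ν
  have h3 : eval ω (p • g - q • e) = p ω • eval ω g := by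
    rw [eval_sub, eval_smul_zeroAtInfty, eval_smul_zeroAtInfty, show q ω = 0 from huv,
      zero_smul, sub_zero]
  rw [← fibreMap_eval θ ω ν h, ← fibreMap_eval θ ω ν h, h3, map_smul, inner_smul_right,
    mul_eq_zero] at h2
  refine h2.resolve_left ?_
  rw [hp, ← inner_eval_eval]
  exact inner_self_ne_zero.2 hu

theorem exists_fibre_linearIsometryEquiv [LocallyCompactSpace Δ] [T2Space Δ] (hF : IsFull Δ F)
    {θ : E ≃ₗ[ℂ] F} (hop : IsOrthogonalityPreserving Ω Δ (θ : E →ₗ[ℂ] F)) {ω : Ω}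
    {ν : Δ} (h : ∀ e : E, eval ω e = 0 → eval ν (θ e) = 0) :
    ∃ (c : ℝ) (J : Fibre E ω ≃ₗᵢ[ℂ] Fibre F ν), 0 < c ∧
      ∀ e : E, eval ν (θ e) = (c : ℂ) • J (eval ω e) := by
  set T := fibreMap (θ : E →ₗ[ℂ] F) ω ν h with hTdef
  have hTe : ∀ e, T (eval ω e) = eval ν (θ e) := fibreMap_eval (θ : E →ₗ[ℂ] F) ω ν h
  obtain ⟨c, hc0, hc⟩ := T.exists_norm_map_eq_mul_norm (inner_fibreMap_eq_zero hop h)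
  have hsurj : ∀ v, ∃ u, T u = v := by
    intro v
    obtain ⟨f, rfl⟩ := eval_surjective ν v
    exact ⟨eval ω (θ.symm f), by rw [hTe, LinearEquiv.apply_symm_apply]⟩
  have hcpos : 0 < c := by
    refine hc0.lt_of_ne' ?_
    rintro rfl
    obtain ⟨f, hf⟩ := hF.exists_eval_ne_zero Δ ν
    obtain ⟨u, hu⟩ := hsurj (eval ν f)
    apply hf
    rw [← norm_eq_zero, ← hu, hc, zero_mul]
  have hcC : (c : ℂ) ≠ 0 := Complex.ofReal_ne_zero.2 hcpos.ne'
  let J₀ : Fibre E ω →ₗᵢ[ℂ] Fibre F ν :=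
    { toLinearMap := (c : ℂ)⁻¹ • T
      norm_map' := fun u => by
        rw [LinearMap.smul_apply, norm_smul, hc, norm_inv, Complex.norm_real,
          Real.norm_of_nonneg hc0, inv_mul_cancel_left₀ hcpos.ne'] }
  have hJ₀ : Function.Surjective J₀ := by
    intro v
    obtain ⟨u, hu⟩ := hsurj ((c : ℂ) • v)
    refine ⟨u, ?_⟩
    change (c : ℂ)⁻¹ • T u = v
    rw [hu, inv_smul_smul₀ hcC]
  refine ⟨c, LinearIsometryEquiv.ofSurjective J₀ hJ₀, hcpos, fun e => ?_⟩
  change _ = (c : ℂ) • (c : ℂ)⁻¹ • T (eval ω e)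
  rw [smul_inv_smul₀ hcC, hTe]

variable (Ω) in
theorem IsFull.exists_bump_eval [LocallyCompactSpace Ω] [T2Space Ω] (hE : IsFull Ω E)
    {ω : Ω} {U : Set Ω} (hU : U ∈ 𝓝 ω) :
    ∃ x : E, ‖eval ω x‖ = 1 ∧ ‖x‖ ≤ 2 ∧ ∀ ω' ∉ U, eval ω' x = 0 := by
  obtain ⟨y, hy⟩ := hE.exists_eval_ne_zero Ω ω
  have hpos : 0 < ‖eval ω y‖ := norm_pos_iff.2 hy
  have hV := inter_mem hU (((continuous_norm_eval y).tendsto ω).eventually_lt_const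
    (by linarith : ‖eval ω y‖ < 2 * ‖eval ω y‖))
  obtain ⟨a, ha1, ha0, han⟩ := exists_bump Ω hV
  have hval : ∀ ω' : Ω, eval ω' (((‖eval ω y‖ : ℂ)⁻¹) • a • y) =
      ((‖eval ω y‖ : ℂ)⁻¹) • a ω' • eval ω' y := fun ω' => by
    rw [eval_smul, eval_smul_zeroAtInfty]
  have hn : ‖((‖eval ω y‖ : ℂ)⁻¹)‖ = ‖eval ω y‖⁻¹ := by
    rw [norm_inv, Complex.norm_real, norm_norm]
  refine ⟨((‖eval ω y‖ : ℂ)⁻¹) • a • y, ?_, ?_, ?_⟩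
  · rw [hval, ha1, one_smul, norm_smul, hn, inv_mul_cancel₀ hpos.ne']
  · refine norm_le_of_eval Ω zero_le_two fun ω' => ?_
    rw [hval, norm_smul, norm_smul, hn, inv_mul_le_iff₀ hpos]
    by_cases h : ω' ∈ U ∩ {ω' | ‖eval ω' y‖ < 2 * ‖eval ω y‖}
    · calc ‖a ω'‖ * ‖eval ω' y‖ ≤ 1 * (2 * ‖eval ω y‖) :=
          mul_le_mul (han ω') (le_of_lt h.2) (norm_nonneg _) zero_le_one
        _ = _ := by ring
    · rw [ha0 ω' h, norm_zero, zero_mul]; positivity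
  · intro ω' h
    rw [hval, ha0 ω' fun h' => h h'.1, zero_smul, smul_zero]

/-- The topology of the base is determined by the sets on which elements do not vanish. -/
theorem continuous_of_isOpen_eval_ne_zero [LocallyCompactSpace Ω] [T2Space Ω] (hE : IsFull Ω E)
    {s : Δ → Ω} (h : ∀ x : E, IsOpen {ν | eval (s ν) x ≠ 0}) : Continuous s := by
  rw [continuous_iff_continuousAt]
  intro ν U hU
  obtain ⟨x, hx1, -, hx⟩ := hE.exists_bump_eval Ω hU
  have hmem : eval (s ν) x ≠ 0 := by
    rw [← norm_ne_zero_iff, hx1]; exact one_ne_zero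
  refine mem_map.2 (mem_of_superset ((h x).mem_nhds hmem) fun ν' hν' => ?_)
  by_contra hn
  exact hν' (hx _ hn)

/-- A section of the bundle that is a continuous multiple of an element of the module is
continuous. -/
theorem continuous_bundle_mk_smul {φ : Δ → ℝ} (hφ : Continuous φ) (f : F)
    (s : ∀ ν : Δ, Fibre F ν) (hs : ∀ ν, s ν = (φ ν : ℂ) • eval ν f) :
    Continuous fun ν : Δ => (⟨ν, s ν⟩ : HilbertBundle Δ F) := by
  refine continuous_generateFrom_iff.2 ?_
  rintro _ ⟨U, g, ε, hU, rfl⟩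
  -- Since `φ` may be unbounded, the section need not come from `F`; expanding the square leaves
  -- only continuous scalar functions.
  have hnorm : ∀ ν, ‖s ν - eval ν g‖ =
      √(φ ν ^ 2 * ‖eval ν f‖ ^ 2 - 2 * (φ ν * RCLike.re ⟪eval ν f, eval ν g⟫_ℂ)
        + ‖eval ν g‖ ^ 2) := by
    intro ν
    rw [hs, ← Real.sqrt_sq (norm_nonneg ((φ ν : ℂ) • eval ν f - eval ν g)),
      norm_sub_sq (𝕜 := ℂ), inner_smul_left, norm_smul, Complex.norm_real, mul_pow,
      Real.norm_eq_abs, sq_abs, Complex.conj_ofReal]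
    simp
  have hcont : Continuous fun ν => ‖s ν - eval ν g‖ := by
    simp only [hnorm]
    have h1 := continuous_norm_eval (Ω := Δ) f
    have h2 := continuous_norm_eval (Ω := Δ) g
    have h3 := RCLike.continuous_re.comp (continuous_inner_eval (Ω := Δ) f g)
    simp only [Function.comp_def] at h3
    fun_prop
  exact hU.inter (isOpen_lt hcont continuous_const)

/-- If `s (t ω) ≠ ω`, an element that is nonzero at `ω` but zero at `s (t ω)` is carried by `θ` and
back to one vanishing at `ω`, yet it is unchanged. -/
theorem leftInverse_of_eval_eq_zero [LocallyCompactSpace Ω] [T2Space Ω] (hE : IsFull Ω E)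
    {θ : E ≃ₗ[ℂ] F} {s : Δ → Ω} {t : Ω → Δ}
    (hs : ∀ ν (e : E), eval (s ν) e = 0 → eval ν (θ e) = 0)
    (ht : ∀ ω (f : F), eval (t ω) f = 0 → eval ω (θ.symm f) = 0) : Function.LeftInverse s t := by
  intro ω
  by_contra hne
  obtain ⟨x, hx1, -, hx⟩ := hE.exists_bump_eval Ω
    (isOpen_compl_singleton.mem_nhds (Ne.symm hne : ω ≠ s (t ω)))
  have h1 := ht ω _ (hs (t ω) x (hx _ (by simp)))
  rw [LinearEquiv.symm_apply_apply] at h1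
  rw [h1, norm_zero] at hx1
  exact zero_ne_one hx1

end HilbertC0Module

end

/-! ### Boundedness and conclusion -/

namespace HilbertC0Module

open Filter Topology

variable {Ω : Type*} [TopologicalSpace Ω]
  {E : Type*} [NormedAddCommGroup E] [NormedSpace ℂ E] [SMul C₀(Ω, ℂ) E] [CStarModule C₀(Ω, ℂ) E]
  {Δ : Type*} [TopologicalSpace Δ]
  {F : Type*} [NormedAddCommGroup F] [NormedSpace ℂ F] [SMul C₀(Δ, ℂ) F] [CStarModule C₀(Δ, ℂ) F]

/-- A linear bijection that scales norms fibrewise along a map of base spaces is bounded, by the closed graph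
theorem. -/
theorem exists_bound_of_norm_eval_eq [CompleteSpace E] [CompleteSpace F] {θ : E ≃ₗ[ℂ] F}
    {s : Δ → Ω} {c : Δ → ℝ} (h : ∀ (e : E) ν, ‖eval ν (θ e)‖ = c ν * ‖eval (s ν) e‖) :
    ∃ C : ℝ, ∀ e : E, ‖θ e‖ ≤ C * ‖e‖ := by
  have hcont : Continuous (θ : E →ₗ[ℂ] F) := by
    refine LinearMap.continuous_of_seq_closed_graph _ fun u x y hu hy => ext_eval Δ fun ν => ?_
    rw [← sub_eq_zero, ← eval_sub, ← norm_eq_zero]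
    have h1 : Tendsto (fun n => ‖eval ν (θ (u n - x))‖) atTop (𝓝 ‖eval ν (y - θ x)‖) := by
      have h2 : Tendsto (fun n => θ (u n) - θ x) atTop (𝓝 (y - θ x)) := hy.sub_const _
      simp only [map_sub]
      exact (((evalL (E := F) ν).continuous.norm).tendsto _).comp h2
    have h3 : Tendsto (fun n => ‖eval ν (θ (u n - x))‖) atTop (𝓝 0) := by
      simp only [h]
      have h4 : Tendsto (fun n => u n - x) atTop (𝓝 0) := by simpa using hu.sub_const x
      have h5 := ((((evalL (E := E) (s ν)).continuous.norm).tendsto 0).comp h4).const_mul (c ν)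
      simpa using! h5
    exact tendsto_nhds_unique h1 h3
  exact ⟨_, (⟨(θ : E →ₗ[ℂ] F), hcont⟩ : E →L[ℂ] F).le_opNorm⟩

end HilbertC0Module

open HilbertC0Module Filter Topology

theorem theorem3p12
    {Ω Δ : Type*} [TopologicalSpace Ω] [LocallyCompactSpace Ω] [T2Space Ω]
    [TopologicalSpace Δ] [LocallyCompactSpace Δ] [T2Space Δ]
    {E : Type*} [NormedAddCommGroup E] [NormedSpace ℂ E] [CompleteSpace E]
    [SMul C₀(Ω, ℂ) E] [CStarModule C₀(Ω, ℂ) E]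
    {F : Type*} [NormedAddCommGroup F] [NormedSpace ℂ F] [CompleteSpace F]
    [SMul C₀(Δ, ℂ) F] [CStarModule C₀(Δ, ℂ) F]
    (hE : HilbertC0Module.IsFull Ω E) (hF : HilbertC0Module.IsFull Δ F)
    (θ : E ≃ₗ[ℂ] F)
    (hql : HilbertC0Module.IsQuasiLocal Ω Δ θ)
    (hql' : HilbertC0Module.IsQuasiLocal Δ Ω θ.symm)
    (hop : HilbertC0Module.IsOrthogonalityPreserving Ω Δ (θ : E →ₗ[ℂ] F))
    (hop' : HilbertC0Module.IsOrthogonalityPreserving Δ Ω (θ.symm : F →ₗ[ℂ] E)) :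
    (∃ C : ℝ, ∀ e : E, ‖θ e‖ ≤ C * ‖e‖) ∧
    ∃ (σ : Δ ≃ₜ Ω) (ψ : BoundedContinuousFunction Δ ℝ)
      (J : ∀ ν : Δ, HilbertC0Module.Fibre E (σ ν) ≃ₗᵢ[ℂ] HilbertC0Module.Fibre F ν),
      (∀ ν, 0 < ψ ν) ∧
      (∀ (e : E) (ν : Δ), HilbertC0Module.eval ν (θ e) =
        (ψ ν : ℂ) • J ν (HilbertC0Module.eval (σ ν) e)) ∧
      ∀ f : E, Continuous fun ν : Δ =>
        (⟨ν, J ν (HilbertC0Module.eval (σ ν) f)⟩ : HilbertC0Module.HilbertBundle Δ F) := by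
  have hθ := hql.isDisjointnessPreserving hop hop'
  have hθ' := hql'.isDisjointnessPreserving hop' hop
  choose s hs using exists_forall_eval_map_eq_zero hF hθ hθ'
  choose t ht using exists_forall_eval_map_eq_zero (θ := θ.symm) hE hθ' hθ
  have hst : Function.LeftInverse s t := leftInverse_of_eval_eq_zero hE hs ht
  have hts : Function.LeftInverse t s := leftInverse_of_eval_eq_zero (θ := θ.symm) hF ht hs
  have hsc : Continuous s := by
    refine continuous_of_isOpen_eval_ne_zero hE fun x => ?_
    -- Localization in both directions gives `x(s ν) = 0` exactly when `θ x` vanishes at `ν`.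
    convert isOpen_eval_ne_zero (Ω := Δ) (θ x) using 1
    ext ν
    refine not_congr ⟨hs ν x, fun h => ?_⟩
    have := ht (s ν) (θ x) (by rwa [hts])
    rwa [LinearEquiv.symm_apply_apply] at this
  have htc : Continuous t := by
    refine continuous_of_isOpen_eval_ne_zero hF fun y => ?_
    convert isOpen_eval_ne_zero (Ω := Ω) (θ.symm y) using 1
    ext ω
    refine not_congr ⟨ht ω y, fun h => ?_⟩
    have := hs (t ω) (θ.symm y) (by rwa [hst])
    rwa [LinearEquiv.apply_symm_apply] at this
  choose c J hc hJ using fun ν => exists_fibre_linearIsometryEquiv hF hop (hs ν)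
  have hnorm : ∀ (e : E) ν, ‖eval ν (θ e)‖ = c ν * ‖eval (s ν) e‖ := fun e ν => by
    rw [hJ, norm_smul, Complex.norm_real, Real.norm_of_nonneg (hc ν).le,
      LinearIsometryEquiv.norm_map]
  obtain ⟨C, hC⟩ := exists_bound_of_norm_eval_eq hnorm
  have hcc : Continuous c := by
    rw [continuous_iff_continuousAt]
    intro ν
    obtain ⟨x, hx1, -, -⟩ := hE.exists_bump_eval Ω (univ_mem (f := 𝓝 (s ν)))
    have hx : ‖eval (s ν) x‖ ≠ 0 := by rw [hx1]; exact one_ne_zero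
    have hxc : Continuous fun ν => ‖eval (s ν) x‖ := (continuous_norm_eval x).comp hsc
    have h1 : ContinuousAt (fun ν => ‖eval ν (θ x)‖ / ‖eval (s ν) x‖) ν :=
      (continuous_norm_eval (θ x)).continuousAt.div hxc.continuousAt hx
    -- Near `ν` the scale `c` is this quotient, because `x ∘ s` stays nonzero there.
    refine h1.congr ?_
    filter_upwards [hxc.continuousAt.eventually_ne hx] with ν' hν'
    rw [hnorm, mul_div_cancel_right₀ _ hν']
  -- The factor `2` bounds the norm of the test element with unit value at `s ν`.
  have hcb : ∀ ν, ‖c ν‖ ≤ |C| * 2 := fun ν => by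
    obtain ⟨x, hx1, hx2, -⟩ := hE.exists_bump_eval Ω (univ_mem (f := 𝓝 (s ν)))
    have h1 := hnorm x ν
    rw [hx1, mul_one] at h1
    rw [Real.norm_of_nonneg (hc ν).le, ← h1]
    calc ‖eval ν (θ x)‖ ≤ ‖θ x‖ := norm_eval_le ν _
      _ ≤ C * ‖x‖ := hC x
      _ ≤ |C| * 2 := by gcongr; exact le_abs_self C
  refine ⟨⟨C, hC⟩, ⟨⟨s, t, hts, hst⟩, hsc, htc⟩,
    BoundedContinuousFunction.ofNormedAddCommGroup c hcc _ hcb, J, hc, fun e ν => hJ ν e,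
    fun f => ?_⟩
  -- The section equals `c⁻¹` times that of `θ f`.
  refine continuous_bundle_mk_smul (hcc.inv₀ fun ν => (hc ν).ne') (θ f) _ fun ν => ?_
  rw [hJ, Pi.inv_apply, Complex.ofReal_inv, inv_smul_smul₀ (Complex.ofReal_ne_zero.2 (hc ν).ne')]
  rfl
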